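/- For a permutation $\sigma$ of $\{0,1\}^n$ ($n\ge 1$) let $\pi=\sigma\circ X_1$, where $X_1$ flips the first bit of a string, and let $D_{\sigma,\ell}$ be the distribution of the string obtained from $0^n$ by applying a uniformly random sequence of $\ell$ maps, each of them $\sigma$ or $\pi$ (independently, with probability $1/2$ each). A quantum algorithm with $T$ queries is given $y\in\{0,1\}^n$ in an input register, with finitely many further qubits all initially $0$. It applies arbitrary unitaries that do not depend on $\sigma$, interleaved with $T$ queries, each of which is $\mathcal O_\sigma:|x\rangle|z\rangle\mapsto|x\rangle|z\oplus\sigma(x)\rangle$ or $\mathcal O_{\sigma^{-1}}:|x\rangle|z\rangle\mapsto|x\rangle|z\oplus\sigma^{-1}(x)\rangle$ (the choice may be controlled by a qubit, and queries may be made in superposition). It then measures in the computational basis and outputs a guess determined by the outcome. Its success probability at depth $\ell$ is the probability that the guess is correct in the following experiment: $\sigma$ is a uniformly random permutation of $\{0,1\}^n$; with probability $1/2$ the string $y$ is drawn from $D_{\sigma,\ell}$, and with probability $1/2$ it is drawn uniformly from $\{0,1\}^n$; the algorithm is run on $y$ with oracles $\sigma,\sigma^{-1}$ and guesses which of the two cases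 holds. The probability is taken over $\sigma$, the case, $y$ and the measurement. **Theorem.** There are absolute constants $c>0$ and $\ell_0\in\mathbb N$ such that for every function $\ell:\mathbb N\to\mathbb N$ with $\ell(n)=o(n)$ the following holds for all sufficiently large $n$ with $\ell(n)\ge\ell_0$: every quantum algorithm that makes fewer than $2^{c\,\ell(n)}$ queries to $\sigma$ and $\sigma^{-1}$ has success probability at most $2/3$ at depth $\ell(n)$. -/

import Mathlib

open Filter Asymptotics
open scoped BigOperators

noncomputable section

namespace ClassicalPR

/-- `n`-bit strings; the bit with index `0` is the first bit. -/
abbrev BitString (n : ℕ) : Type := Fin n → Bool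

/-- The string `0^n`. -/
def zeroString (n : ℕ) : BitString n := fun _ => false

/-- Bitwise exclusive or. -/
def xorString {n : ℕ} (x y : BitString n) : BitString n := fun i => xor (x i) (y i)

theorem xorString_cancel {n : ℕ} (x y : BitString n) : xorString (xorString x y) y = x := by
  funext i
  simp [xorString]

/-- The map `X_1`, which flips the first bit and keeps all the others. -/
def flipFirst {n : ℕ} (x : BitString n) : BitString n :=
  fun i => if i.val = 0 then !(x i) else x i

/-- One step of the process: `σ` if `b = false`, and `π = σ ∘ X_1` if `b = true`. -/
def step {n : ℕ} (σ : Equiv.Perm (BitString n)) (b : Bool) (x : BitString n) : BitString n :=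
  if b then σ (flipFirst x) else σ x

/-- The string reached from `0^n` by the sequence of steps `s 0`, `s 1`, ..., `s (ℓ - 1)`,
`s 0` being applied first. -/
def endpoint {n : ℕ} (σ : Equiv.Perm (BitString n)) : (ℓ : ℕ) → (Fin ℓ → Bool) → BitString n
  | 0, _ => zeroString n
  | k + 1, s => step σ (s (Fin.last k)) (endpoint σ k (fun i => s i.castSucc))

/-- The distribution `D_σ`: the endpoint of a uniformly random sequence of `ℓ` steps. -/
def leafDist {n : ℕ} (σ : Equiv.Perm (BitString n)) (ℓ : ℕ) : PMF (BitString n) :=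
  (PMF.uniformOfFintype (Fin ℓ → Bool)).map (endpoint σ ℓ)

/-- Labels `(d, x, z, y, w)` of the computational basis: one qubit `d` for the direction of the
query, `n` qubits `x` for the query, `n` qubits `z` for the answer, `n` qubits `y` for the
input string, and `m` ancilla qubits `w`. -/
abbrev Basis (n m : ℕ) : Type :=
  Bool × BitString n × BitString n × BitString n × BitString m

instance instDecidableEqBasis (n m : ℕ) : DecidableEq (Basis n m) :=
  @instDecidableEqProd _ _ _ (@instDecidableEqProd _ _ _ inferInstance)

/-- The Hilbert space of all the qubits. -/
abbrev StateSpace (n m : ℕ) : Type := EuclideanSpace ℂ (Basis n m)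

/-- The action of a query on basis labels:
`(d, x, z, y, w) ↦ (d, x, z ⊕ σ x, y, w)` if `d = false`, and
`(d, x, z, y, w) ↦ (d, x, z ⊕ σ⁻¹ x, y, w)` if `d = true`. -/
def queryMap {n m : ℕ} (σ : Equiv.Perm (BitString n)) (b : Basis n m) : Basis n m :=
  (b.1, b.2.1, xorString b.2.2.1 (bif b.1 then σ.symm b.2.1 else σ b.2.1), b.2.2.2)

theorem queryMap_involutive {n m : ℕ} (σ : Equiv.Perm (BitString n)) :
    Function.Involutive (queryMap (m := m) σ) := by
  rintro ⟨d, x, z, r⟩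
  exact congrArg (fun u => (d, x, u, r)) (xorString_cancel z _)

/-- The query operator. On basis states it is the standard oracle
`|x⟩|z⟩ ↦ |x⟩|z ⊕ σ x⟩` or `|x⟩|z⟩ ↦ |x⟩|z ⊕ σ⁻¹ x⟩`, the direction qubit deciding between
the two; by linearity it may be applied to any superposition. -/
def oracle {n m : ℕ} (σ : Equiv.Perm (BitString n)) :
    StateSpace n m ≃ₗᵢ[ℂ] StateSpace n m :=
  LinearIsometryEquiv.piLpCongrLeft 2 ℂ ℂ (queryMap_involutive (m := m) σ).toPerm

/-- A quantum query algorithm on `n`-bit inputs: a number of ancilla qubits, a number of queries,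
arbitrary unitaries `gate 0`, ..., `gate queries` applied before, between and after the queries
(the later ones are not used), and the set of outcomes of the final measurement in the
computational basis on which the algorithm answers `true`. -/
structure QueryAlgorithm (n : ℕ) where
  ancillas : ℕ
  queries : ℕ
  gate : ℕ → (StateSpace n ancillas ≃ₗᵢ[ℂ] StateSpace n ancillas)
  accept : Basis n ancillas → Bool

namespace QueryAlgorithm

/-- The initial state: the input register holds `y`, all other qubits are `0`. -/
def initState {n : ℕ} (A : QueryAlgorithm n) (y : BitString n) : StateSpace n A.ancillas :=
  EuclideanSpace.single
    (false, zeroString n, zeroString n, y, zeroString A.ancillas) (1 : ℂ)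

/-- The state after `t` queries and the unitary that follows the last of them. -/
def stateAfter {n : ℕ} (A : QueryAlgorithm n) (σ : Equiv.Perm (BitString n)) (y : BitString n) :
    ℕ → StateSpace n A.ancillas
  | 0 => A.gate 0 (A.initState y)
  | t + 1 => A.gate (t + 1) (oracle σ (A.stateAfter σ y t))

/-- The probability that the algorithm answers `true` on input `y` with oracle `σ`. -/
def acceptProb {n : ℕ} (A : QueryAlgorithm n) (σ : Equiv.Perm (BitString n))
    (y : BitString n) : ℝ :=
  ∑ b : Basis n A.ancillas, if A.accept b then ‖A.stateAfter σ y A.queries b‖ ^ 2 else 0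

/-- The probability, over a uniformly random permutation `σ`, a fair coin that decides whether `y`
is drawn from `D_σ` or uniformly from all `n`-bit strings, the draw of `y`, and the measurement,
that the algorithm is right, where the answer `true` stands for `D_σ` and `false` for uniform. -/
def successProb {n : ℕ} (A : QueryAlgorithm n) (ℓ : ℕ) : ℝ :=
  (∑ σ : Equiv.Perm (BitString n),
      ((1 / 2) * ∑ y : BitString n, (leafDist σ ℓ y).toReal * A.acceptProb σ y
        + (1 / 2) * ∑ y : BitString n, ((2 : ℝ) ^ n)⁻¹ * (1 - A.acceptProb σ y)))
    / (Fintype.card (Equiv.Perm (BitString n)) : ℝ)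

end QueryAlgorithm

end ClassicalPR

end

noncomputable section

namespace ClassicalPR

/-! The points at which the walks evaluate `σ` form a binary tree, whose root is `0^n` or `X_1 0^n`
according to the first step. Cut the walk to a leaf at the point `u` reached by the next `2r`
branchings, and exchange the values of `σ` at `u` and at a uniformly random point `v`. Unless the
tree has a coincidence or `v` lies on the path, the exchanged permutation `σ'` leads from `v` along
the remaining `m` branchings to the same leaf `y` (`apply_node_swap`). The exchange is invertible,
so `(σ', v)` may be taken uniform; for fixed `σ'` the map from `v` to `y` is a bijection, so `y` is
uniform and independent of `σ'` (`sum_leaf_le`). A leaf instance is therefore nearly a uniform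
instance `(σ', y)` in which two values of `σ'` have been exchanged.

Given `σ'` and `y`, the point `u` is hidden among `2 ^ (2r)` distinct points of the forward tree,
and `v` among `2 ^ m` distinct points reached backwards from `y`. By the hybrid argument, `T`
queries notice the exchange with advantage at most `8T / 2 ^ r` (`sum_acceptProb_swap_le`).
Coincidences have probability `O(4 ^ ℓ / 2 ^ n)` (`card_not_treeInjective`), which vanishes for `ℓ =
o(n)`. Taking `r` close to `ℓ / 4` gives the theorem. -/

/-! ### The binary tree of evaluation points -/

/-- Apply `X_1` if `b = true`. -/
def flipIf {n : ℕ} (b : Bool) (x : BitString n) : BitString n := if b then flipFirst x else x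

theorem flipFirst_flipFirst {n : ℕ} (x : BitString n) : flipFirst (flipFirst x) = x := by
  funext i
  by_cases h : i.val = 0 <;> simp [flipFirst, h]

theorem flipFirst_ne {n : ℕ} (hn : 0 < n) (x : BitString n) : flipFirst x ≠ x := by
  intro h
  have := congrFun h ⟨0, hn⟩
  simp [flipFirst] at this

theorem flipIf_flipIf {n : ℕ} (b : Bool) (x : BitString n) : flipIf b (flipIf b x) = x := by
  cases b <;> simp [flipIf, flipFirst_flipFirst]

theorem flipIf_injective {n : ℕ} (b : Bool) :
    Function.Injective (flipIf b : BitString n → BitString n) :=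
  Function.Involutive.injective (flipIf_flipIf b)

theorem step_eq_flipIf {n : ℕ} (σ : Equiv.Perm (BitString n)) (b : Bool) (x : BitString n) :
    step σ b x = σ (flipIf b x) := by
  cases b <;> rfl

/-- The node of the binary tree with root `a` and children `τ x`, `X_1 (τ x)` of `x` that is
addressed by a word, the head of the word being the last branching. -/
def node {n : ℕ} (τ : Equiv.Perm (BitString n)) (a : BitString n) : List Bool → BitString n
  | [] => a
  | b :: L => flipIf b (τ (node τ a L))

theorem node_append {n : ℕ} (τ : Equiv.Perm (BitString n)) (a : BitString n) (L M : List Bool) :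
    node τ a (L ++ M) = node τ (node τ a M) L := by
  induction L with
  | nil => rfl
  | cons b L ih => simp only [List.cons_append, node, ih]

/-- A node depends only on the values of the permutation at its proper ancestors. -/
theorem node_congr {n : ℕ} {τ τ' : Equiv.Perm (BitString n)} {a : BitString n} (L : List Bool)
    (h : ∀ K, K <:+ L → K.length < L.length → τ' (node τ a K) = τ (node τ a K)) :
    node τ' a L = node τ a L := by
  induction L with
  | nil => rfl
  | cons b L ih =>
    have hL : node τ' a L = node τ a L := by
      refine ih fun K hK hlt => h K (hK.trans (List.suffix_cons b L)) ?_
      simp only [List.length_cons]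
      omega
    rw [node, node, hL, h L (List.suffix_cons b L) (by simp)]

/-- The words of length at most `j`. -/
def shortWords : ℕ → Finset (List Bool)
  | 0 => {[]}
  | j + 1 => insert [] ((shortWords j).image (List.cons true) ∪ (shortWords j).image (List.cons false))

theorem mem_shortWords {j : ℕ} {L : List Bool} : L ∈ shortWords j ↔ L.length ≤ j := by
  induction j generalizing L with
  | zero => simp [shortWords]
  | succ j ih =>
    cases L with
    | nil => simp [shortWords]
    | cons b L => cases b <;> simp [shortWords, ih]

theorem card_shortWords (j : ℕ) : (shortWords j).card + 1 ≤ 2 ^ (j + 1) := by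
  induction j with
  | zero => simp [shortWords]
  | succ j ih =>
    have h1 := Finset.card_insert_le ([] : List Bool)
      ((shortWords j).image (List.cons true) ∪ (shortWords j).image (List.cons false))
    have h2 := Finset.card_union_le ((shortWords j).image (List.cons true))
      ((shortWords j).image (List.cons false))
    have h3 := Finset.card_image_le (s := shortWords j) (f := List.cons true)
    have h4 := Finset.card_image_le (s := shortWords j) (f := List.cons false)
    rw [shortWords, pow_succ]
    omega

/-- The tree with root `a` has no coincidences up to depth `j`. -/
def TreeInjective {n : ℕ} (τ : Equiv.Perm (BitString n)) (a : BitString n) (j : ℕ) : Prop :=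
  Set.InjOn (node τ a) {L | L.length ≤ j}

theorem TreeInjective.mono {n : ℕ} {τ : Equiv.Perm (BitString n)} {a : BitString n} {i j : ℕ}
    (h : TreeInjective τ a j) (hij : i ≤ j) : TreeInjective τ a i :=
  Set.InjOn.mono (fun _ hL => le_trans hL hij) h

/-- The values of `τ` at the node `M` that create a coincidence at depth `j + 1`. -/
def collisionSet {n : ℕ} (a : BitString n) (j : ℕ) (M : List Bool) (τ : Equiv.Perm (BitString n)) :
    Finset (BitString n) :=
  insert a (insert (flipFirst a)
    (((shortWords j).erase M).image fun K => flipFirst (τ (node τ a K))))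

theorem card_collisionSet {n : ℕ} (a : BitString n) (j : ℕ) (M : List Bool)
    (τ : Equiv.Perm (BitString n)) : (collisionSet a j M τ).card ≤ 2 ^ (j + 2) := by
  have h1 := Finset.card_insert_le a (insert (flipFirst a)
    (((shortWords j).erase M).image fun K => flipFirst (τ (node τ a K))))
  have h2 := Finset.card_insert_le (flipFirst a)
    (((shortWords j).erase M).image fun K => flipFirst (τ (node τ a K)))
  have h3 := Finset.card_image_le (s := (shortWords j).erase M)
    (f := fun K => flipFirst (τ (node τ a K)))
  have h4 := Finset.card_erase_le (s := shortWords j) (a := M)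
  have h5 := card_shortWords j
  have h6 : 2 ≤ 2 ^ (j + 1) := by
    rw [pow_succ]
    have := Nat.one_le_two_pow (n := j)
    omega
  rw [collisionSet, pow_succ]
  omega

/-- A new coincidence involves a child of some `M` of length `j`. Siblings differ because `X_1` has
no fixed point; equal branchings of different parents reduce to depth `j` by injectivity; the root
and opposite branchings are what `collisionSet` forbids. -/
theorem TreeInjective.succ {n : ℕ} (hn : 0 < n) {τ : Equiv.Perm (BitString n)} {a : BitString n}
    {j : ℕ} (h : TreeInjective τ a j)
    (hS : ∀ M : List Bool, M.length = j → τ (node τ a M) ∉ collisionSet a j M τ) :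
    TreeInjective τ a (j + 1) := by
  have key : ∀ L L' : List Bool, L.length ≤ j + 1 → L'.length ≤ L.length →
      node τ a L = node τ a L' → L = L' := by
    intro L L' hL hL' he
    rcases Nat.lt_or_ge j L.length with hj | hj
    · obtain _ | ⟨b, M⟩ := L
      · simp at hj
      have hM : M.length = j := by
        simp only [List.length_cons] at hL hj
        omega
      obtain _ | ⟨b', M'⟩ := L'
      · exfalso
        refine hS M hM ?_
        have : τ (node τ a M) = flipIf b a := by
          rw [← flipIf_flipIf b (τ (node τ a M))]
          exact congrArg _ he
        rw [this]
        cases b <;> simp [flipIf, collisionSet]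
      · have hM' : M'.length ≤ j := by
          simp only [List.length_cons] at hL'
          omega
        simp only [node] at he
        by_cases hMM : M = M'
        · subst hMM
          have hne := flipFirst_ne hn (τ (node τ a M))
          cases b <;> cases b'
          · rfl
          · exact absurd he.symm hne
          · exact absurd he hne
          · rfl
        · exfalso
          by_cases hb : b = b'
          · subst hb
            exact hMM (h hM.le hM' (τ.injective (flipIf_injective b he)))
          · refine hS M hM ?_
            have : τ (node τ a M) = flipFirst (τ (node τ a M')) := by
              cases b <;> cases b'
              · exact absurd rfl hb
              · exact he
              · exact (flipFirst_flipFirst _).symm.trans (congrArg flipFirst he)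
              · exact absurd rfl hb
            rw [this]
            refine Finset.mem_insert_of_mem (Finset.mem_insert_of_mem ?_)
            exact Finset.mem_image_of_mem (fun K => flipFirst (τ (node τ a K)))
              (Finset.mem_erase.2 ⟨fun h => hMM h.symm, mem_shortWords.2 hM'⟩)
    · exact h hj (hL'.trans hj) he
  intro L hL L' hL' he
  rcases le_total L'.length L.length with hle | hle
  · exact key L L' hL hle he
  · exact (key L' L hL' hle he.symm).symm

/-! ### Probability of a coincidence -/

/-- If the value of a random permutation at the point `q` can be exchanged with its value at any
point outside `R` without changing `q` and `S`, then it is unlikely to be in `S`. -/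
theorem card_mul_le_of_exchange {α : Type*} [Fintype α] [DecidableEq α]
    (E : Finset (Equiv.Perm α)) (q : Equiv.Perm α → α) (S R : Equiv.Perm α → Finset α) (r s : ℕ)
    (hE : ∀ σ ∈ E, σ (q σ) ∈ S σ) (hS : ∀ σ, (S σ).card ≤ s) (hR : ∀ σ ∈ E, (R σ).card ≤ r)
    (hq : ∀ σ ∈ E, ∀ v ∉ R σ, q (σ * Equiv.swap (q σ) v) = q σ)
    (hSq : ∀ σ ∈ E, ∀ v ∉ R σ, S (σ * Equiv.swap (q σ) v) = S σ) :
    E.card * (Fintype.card α - r) ≤ Fintype.card (Equiv.Perm α) * s := by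
  have h1 : E.card * (Fintype.card α - r) ≤ (E.sigma fun σ => (R σ)ᶜ).card := by
    rw [Finset.card_sigma, ← smul_eq_mul]
    refine Finset.card_nsmul_le_sum _ _ _ fun σ hσ => ?_
    rw [Finset.card_compl]
    exact Nat.sub_le_sub_left (hR σ hσ) _
  have h2 : ((Finset.univ : Finset (Equiv.Perm α)).sigma S).card
      ≤ Fintype.card (Equiv.Perm α) * s := by
    rw [Finset.card_sigma, ← smul_eq_mul]
    exact Finset.sum_le_card_nsmul _ _ _ fun σ _ => hS σ
  refine h1.trans (le_trans ?_ h2)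
  -- The pair consists of the exchanged permutation and the old value at `q`. The former determines
  -- `q`, and `v` is the point where it takes the old value, so the exchange can be undone.
  refine Finset.card_le_card_of_injOn
    (fun p : (_ : Equiv.Perm α) × α => ⟨p.1 * Equiv.swap (q p.1) p.2, p.1 (q p.1)⟩) ?_ ?_
  · rintro ⟨σ, v⟩ hp
    simp only [Finset.coe_sigma, Set.mem_sigma_iff, Finset.mem_coe, Finset.mem_compl] at hp
    simp only [Finset.coe_sigma, Set.mem_sigma_iff, Finset.mem_coe, Finset.mem_univ, true_and]
    rw [hSq σ hp.1 v hp.2]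
    exact hE σ hp.1
  · rintro ⟨σ, v⟩ hp ⟨σ', v'⟩ hp' he
    simp only [Finset.coe_sigma, Set.mem_sigma_iff, Finset.mem_coe, Finset.mem_compl] at hp hp'
    simp only [Sigma.mk.injEq, heq_eq_eq] at he
    have hqq : q σ = q σ' := by
      rw [← hq σ hp.1 v hp.2, he.1, hq σ' hp'.1 v' hp'.2]
    have hv : v = v' := by
      have e1 : (σ * Equiv.swap (q σ) v) v = (σ' * Equiv.swap (q σ') v') v' := by
        simp [he.2]
      rw [he.1] at e1
      exact (σ' * Equiv.swap (q σ') v').injective e1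
    subst hv
    have := he.1
    rw [hqq] at this
    rw [mul_right_cancel this]

theorem card_bitString (n : ℕ) : Fintype.card (BitString n) = 2 ^ n := by simp

theorem swap_apply_node {n : ℕ} (τ : Equiv.Perm (BitString n)) {u v x : BitString n}
    (hu : x ≠ u) (hv : x ≠ v) : (τ * Equiv.swap u v) x = τ x := by
  rw [Equiv.Perm.mul_apply, Equiv.swap_apply_of_ne_of_ne hu hv]

-- Exchanging the value at `M` with that at a point off the tree moves no node of depth at most `j`
-- and changes no value at the other words; hence the erasure of `M` in `collisionSet`. At least
-- half of all points lie off the tree, which costs a factor 2.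
open Classical in
theorem card_collision {n : ℕ} (a : BitString n) (j : ℕ) (M : List Bool) (hM : M.length = j)
    (hj : 2 ^ (j + 2) ≤ 2 ^ n) :
    (Finset.univ.filter fun τ : Equiv.Perm (BitString n) =>
      TreeInjective τ a j ∧ τ (node τ a M) ∈ collisionSet a j M τ).card * 2 ^ n
      ≤ 2 ^ (j + 3) * Fintype.card (Equiv.Perm (BitString n)) := by
  have hnode : ∀ τ : Equiv.Perm (BitString n), TreeInjective τ a j →
      ∀ v ∉ (shortWords j).image (node τ a), ∀ K : List Bool, K.length ≤ j →
      node (τ * Equiv.swap (node τ a M) v) a K = node τ a K := by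
    intro τ hτ v hv K hK
    refine node_congr K fun K' _ hlt => swap_apply_node τ (fun h => ?_) (fun h => ?_)
    · have : K' = M := hτ (show K'.length ≤ j by omega) hM.le h
      rw [this] at hlt
      omega
    · exact hv (h ▸ Finset.mem_image_of_mem _ (mem_shortWords.2 (by omega)))
  have h := card_mul_le_of_exchange (Finset.univ.filter fun τ : Equiv.Perm (BitString n) =>
      TreeInjective τ a j ∧ τ (node τ a M) ∈ collisionSet a j M τ)
    (fun τ => node τ a M) (collisionSet a j M) (fun τ => (shortWords j).image (node τ a))
    (2 ^ (j + 1)) (2 ^ (j + 2)) (fun τ hτ => (Finset.mem_filter.1 hτ).2.2)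
    (card_collisionSet a j M)
    (fun τ _ => by
      have := Finset.card_image_le (s := shortWords j) (f := node τ a)
      have := card_shortWords j
      omega)
    (fun τ hτ v hv => hnode τ (Finset.mem_filter.1 hτ).2.1 v hv M hM.le)
    (fun τ hτ v hv => by
      have hinj := (Finset.mem_filter.1 hτ).2.1
      unfold collisionSet
      congr 2
      refine Finset.image_congr fun K hK => ?_
      obtain ⟨hKM, hK⟩ := Finset.mem_erase.1 (Finset.mem_coe.1 hK)
      have hKj := mem_shortWords.1 hK
      have hKv : node τ a K ≠ v := by
        rintro rfl
        exact hv (Finset.mem_image_of_mem _ hK)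
      exact congrArg flipFirst ((congrArg _ (hnode τ hinj v hv K hKj)).trans
        (swap_apply_node τ (fun h => hKM (hinj hKj hM.le h)) hKv)))
  rw [card_bitString] at h
  have h2 : 2 ^ n ≤ 2 * (2 ^ n - 2 ^ (j + 1)) := by
    rw [pow_succ] at hj
    omega
  calc _ ≤ _ * (2 * (2 ^ n - 2 ^ (j + 1))) := Nat.mul_le_mul_left _ h2
    _ = 2 * (_ * (2 ^ n - 2 ^ (j + 1))) := by ring
    _ ≤ 2 * (Fintype.card (Equiv.Perm (BitString n)) * 2 ^ (j + 2)) := Nat.mul_le_mul_left _ h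
    _ = _ := by ring

open Classical in
/-- A random permutation has no coincidences up to depth `j`, except with probability at most
`2 * 4 ^ (j + 1) / 2 ^ n`. -/
theorem card_not_treeInjective {n : ℕ} (hn : 0 < n) (a : BitString n) (j : ℕ)
    (hj : 2 ^ (j + 1) ≤ 2 ^ n) :
    (Finset.univ.filter fun τ : Equiv.Perm (BitString n) => ¬ TreeInjective τ a j).card * 2 ^ n
      ≤ 2 * 4 ^ (j + 1) * Fintype.card (Equiv.Perm (BitString n)) := by
  induction j with
  | zero =>
    have : (Finset.univ.filter fun τ : Equiv.Perm (BitString n) => ¬ TreeInjective τ a 0) = ∅ := by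
      refine Finset.filter_eq_empty_iff.2 fun τ _ => not_not.2 ?_
      intro L hL L' hL' _
      simp only [Set.mem_ofPred_eq, Nat.le_zero, List.length_eq_zero_iff] at hL hL'
      rw [hL, hL']
    rw [this]
    simp
  | succ j ih =>
    -- Union bound: either a coincidence exists by depth `j`, or some word of length `j` creates
    -- one.
    have hsub : (Finset.univ.filter fun τ : Equiv.Perm (BitString n) => ¬ TreeInjective τ a (j + 1))
        ⊆ (Finset.univ.filter fun τ : Equiv.Perm (BitString n) => ¬ TreeInjective τ a j) ∪
          ((shortWords j).filter fun M => M.length = j).biUnion fun M =>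
            Finset.univ.filter fun τ : Equiv.Perm (BitString n) =>
              TreeInjective τ a j ∧ τ (node τ a M) ∈ collisionSet a j M τ := by
      intro τ hτ
      by_contra hcon
      simp only [Finset.mem_union, Finset.mem_filter, Finset.mem_univ, true_and,
        Finset.mem_biUnion, not_or, not_not, not_exists, not_and] at hτ hcon
      exact hτ (hcon.1.succ hn fun M hM => hcon.2 M ⟨mem_shortWords.2 hM.le, hM⟩ hcon.1)
    have h1 := (Finset.card_le_card hsub).trans (Finset.card_union_le _ _)
    have h2 : (((shortWords j).filter fun M => M.length = j).biUnion fun M =>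
            Finset.univ.filter fun τ : Equiv.Perm (BitString n) =>
              TreeInjective τ a j ∧ τ (node τ a M) ∈ collisionSet a j M τ).card * 2 ^ n
        ≤ 2 ^ (j + 1) * (2 ^ (j + 3) * Fintype.card (Equiv.Perm (BitString n))) := by
      refine (Nat.mul_le_mul_right _ Finset.card_biUnion_le).trans ?_
      rw [Finset.sum_mul]
      refine (Finset.sum_le_card_nsmul _ _ _ fun M hM =>
        card_collision a j M (Finset.mem_filter.1 hM).2 hj).trans ?_
      rw [smul_eq_mul]
      refine Nat.mul_le_mul_right _ ?_
      have := Finset.card_filter_le (shortWords j) fun M => M.length = j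
      have := card_shortWords j
      omega
    have h3 := ih (le_trans (Nat.pow_le_pow_right (by norm_num) (by omega)) hj)
    calc _ ≤ _ := Nat.mul_le_mul_right _ h1
      _ ≤ 2 * 4 ^ (j + 1) * Fintype.card (Equiv.Perm (BitString n)) +
          2 ^ (j + 1) * (2 ^ (j + 3) * Fintype.card (Equiv.Perm (BitString n))) := by
        rw [add_mul]
        exact Nat.add_le_add h3 h2
      _ ≤ _ := by
        -- The old and new terms add up to `6 * 4 ^ (j + 1)`, below the allowed `8 * 4 ^ (j + 1)`.
        have e : (2 : ℕ) ^ (j + 1) * 2 ^ (j + 3) = 4 * 4 ^ (j + 1) := by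
          rw [show (4 : ℕ) = 2 ^ 2 by norm_num, ← pow_mul, ← pow_add, ← pow_add]
          congr 1
          ring
        rw [← mul_assoc, e, pow_succ 4 (j + 1), ← add_mul]
        refine Nat.mul_le_mul_right _ ?_
        omega

/-! ### Query mass and the hybrid argument -/

theorem oracle_apply {n m : ℕ} (σ : Equiv.Perm (BitString n)) (ψ : StateSpace n m) (b : Basis n m) :
    oracle σ ψ b = ψ (queryMap σ b) := rfl

/-- The probability that a query has direction `d` and query string `x`. -/
def queryMass {n m : ℕ} (ψ : StateSpace n m) (d : Bool) (x : BitString n) : ℝ :=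
  ∑ b : Basis n m, if b.1 = d ∧ b.2.1 = x then ‖ψ b‖ ^ 2 else 0

theorem queryMass_nonneg {n m : ℕ} (ψ : StateSpace n m) (d : Bool) (x : BitString n) :
    0 ≤ queryMass ψ d x :=
  Finset.sum_nonneg fun b _ => by split_ifs <;> positivity

theorem sum_queryMass_le {n m : ℕ} (ψ : StateSpace n m) (d : Bool) :
    ∑ x, queryMass ψ d x ≤ ‖ψ‖ ^ 2 := by
  unfold queryMass
  rw [Finset.sum_comm, EuclideanSpace.norm_sq_eq]
  refine Finset.sum_le_sum fun b _ => ?_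
  by_cases h : b.1 = d
  · simp [h]
  · simp [h]

/-- The expected probability of querying a random point, all of whose values are different. -/
theorem sum_queryMass_comp_le {n m : ℕ} {ι : Type*} [Fintype ι] (ψ : StateSpace n m) (d : Bool)
    (g : ι → BitString n) (hg : Function.Injective g) :
    ∑ i, queryMass ψ d (g i) ≤ ‖ψ‖ ^ 2 := by
  classical
  refine le_trans ?_ (sum_queryMass_le ψ d)
  rw [← Finset.sum_image (f := queryMass ψ d) (s := Finset.univ) (g := g) (fun _ _ _ _ h => hg h)]
  exact Finset.sum_le_sum_of_subset_of_nonneg (Finset.subset_univ _)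
    fun x _ _ => queryMass_nonneg ψ d x

/-- The probability of querying one of the points where the permutations `σ` and `σ * swap u v`,
or their inverses, differ. -/
def swapMass {n m : ℕ} (ψ : StateSpace n m) (σ : Equiv.Perm (BitString n)) (u v : BitString n) :
    ℝ :=
  queryMass ψ false u + queryMass ψ true (σ u) + (queryMass ψ false v + queryMass ψ true (σ v))

/-- The oracles differ only on labels that query an exchanged point, where `‖p - q‖² ≤ 2‖p‖² +
2‖q‖²`. A query preserves direction and query string, so each of the two sums is again the mass of
`ψ`. -/
theorem norm_oracle_sub_sq_le {n m : ℕ} (ψ : StateSpace n m) (σ : Equiv.Perm (BitString n))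
    (u v : BitString n) :
    ‖oracle (σ * Equiv.swap u v) ψ - oracle σ ψ‖ ^ 2 ≤ 4 * swapMass ψ σ u v := by
  set D : Basis n m → ℝ := fun b =>
    (if b.1 = false ∧ b.2.1 = u then 1 else 0) + (if b.1 = true ∧ b.2.1 = σ u then 1 else 0) +
      ((if b.1 = false ∧ b.2.1 = v then 1 else 0) + (if b.1 = true ∧ b.2.1 = σ v then 1 else 0))
    with hD
  have hD0 : ∀ b, 0 ≤ D b := fun b => by
    simp only [hD]
    positivity
  have hsum : ∑ b : Basis n m, D b * ‖ψ b‖ ^ 2 = swapMass ψ σ u v := by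
    simp only [swapMass, queryMass, hD, ← Finset.sum_add_distrib, add_mul, ite_mul, one_mul,
      zero_mul]
  have hsumq : ∀ ρ : Equiv.Perm (BitString n),
      ∑ b : Basis n m, D b * ‖ψ (queryMap ρ b)‖ ^ 2 = swapMass ψ σ u v := fun ρ => by
    rw [← hsum, ← Equiv.sum_comp (queryMap_involutive (m := m) ρ).toPerm fun b => D b * ‖ψ b‖ ^ 2]
    exact Finset.sum_congr rfl fun b _ => rfl
  have hpt : ∀ b : Basis n m, ‖(oracle (σ * Equiv.swap u v) ψ - oracle σ ψ) b‖ ^ 2 ≤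
      2 * (D b * ‖ψ (queryMap (σ * Equiv.swap u v) b)‖ ^ 2) +
        2 * (D b * ‖ψ (queryMap σ b)‖ ^ 2) := by
    intro b
    rw [PiLp.sub_apply, oracle_apply, oracle_apply]
    by_cases hb : queryMap (σ * Equiv.swap u v) b = queryMap σ b
    · rw [hb, sub_self, norm_zero, zero_pow two_ne_zero]
      have := hD0 b
      positivity
    · have h1 : 1 ≤ D b := by
        by_contra hlt
        refine hb ?_
        obtain ⟨d, x, z, r⟩ := b
        have e : (bif d then (σ * Equiv.swap u v).symm x else (σ * Equiv.swap u v) x) =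
            bif d then σ.symm x else σ x := by
          cases d
          · have hx : x ≠ u ∧ x ≠ v := by
              constructor
              · rintro rfl
                simp only [hD] at hlt
                simp at hlt
                split_ifs at hlt <;> norm_num at hlt
              · rintro rfl
                simp only [hD] at hlt
                simp at hlt
                split_ifs at hlt <;> norm_num at hlt
            simp [Equiv.swap_apply_of_ne_of_ne hx.1 hx.2]
          · have hx : x ≠ σ u ∧ x ≠ σ v := by
              constructor
              · rintro rfl
                simp only [hD] at hlt
                simp at hlt
                split_ifs at hlt <;> norm_num at hlt
              · rintro rfl
                simp only [hD] at hlt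
                simp at hlt
                split_ifs at hlt <;> norm_num at hlt
            have e1 : (σ * Equiv.swap u v).symm x = Equiv.swap u v (σ.symm x) := rfl
            simp only [cond_true, e1]
            exact Equiv.swap_apply_of_ne_of_ne (fun h => hx.1 (by rw [← h]; simp))
              (fun h => hx.2 (by rw [← h]; simp))
        exact congrArg (fun w => (d, x, xorString z w, r)) e
      set p := ψ (queryMap (σ * Equiv.swap u v) b)
      set q := ψ (queryMap σ b)
      have h2 := norm_sub_le p q
      have h3 : ‖p - q‖ ^ 2 ≤ (‖p‖ + ‖q‖) ^ 2 := pow_le_pow_left₀ (norm_nonneg _) h2 2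
      have h4 : ‖p‖ ^ 2 ≤ D b * ‖p‖ ^ 2 := le_mul_of_one_le_left (by positivity) h1
      have h5 : ‖q‖ ^ 2 ≤ D b * ‖q‖ ^ 2 := le_mul_of_one_le_left (by positivity) h1
      nlinarith [sq_nonneg (‖p‖ - ‖q‖)]
  rw [EuclideanSpace.norm_sq_eq]
  refine (Finset.sum_le_sum fun b _ => hpt b).trans ?_
  rw [Finset.sum_add_distrib, ← Finset.mul_sum, ← Finset.mul_sum, hsumq, hsumq]
  linarith

namespace QueryAlgorithm

theorem norm_stateAfter {n : ℕ} (A : QueryAlgorithm n) (σ : Equiv.Perm (BitString n))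
    (y : BitString n) (t : ℕ) : ‖A.stateAfter σ y t‖ = 1 := by
  induction t with
  | zero => simp [stateAfter, initState]
  | succ t ih => simp [stateAfter, ih]

/-- The hybrid argument: the final states for two oracles differ by at most the sum of the
differences that the single queries make. -/
theorem norm_stateAfter_sub_le {n : ℕ} (A : QueryAlgorithm n) (ρ σ : Equiv.Perm (BitString n))
    (y : BitString n) (t : ℕ) :
    ‖A.stateAfter ρ y t - A.stateAfter σ y t‖ ≤
      ∑ i ∈ Finset.range t, ‖oracle ρ (A.stateAfter σ y i) - oracle σ (A.stateAfter σ y i)‖ := by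
  induction t with
  | zero => simp [stateAfter]
  | succ t ih =>
    rw [Finset.sum_range_succ, stateAfter, stateAfter, ← map_sub, LinearIsometryEquiv.norm_map]
    -- The middle term applies `ρ` to the run with `σ`, so all errors are measured along that one
    -- run.
    refine (norm_sub_le_norm_sub_add_norm_sub _ (oracle ρ (A.stateAfter σ y t)) _).trans ?_
    rw [← map_sub, LinearIsometryEquiv.norm_map]
    exact add_le_add_left ih _

theorem acceptProb_nonneg {n : ℕ} (A : QueryAlgorithm n) (σ : Equiv.Perm (BitString n))
    (y : BitString n) : 0 ≤ A.acceptProb σ y :=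
  Finset.sum_nonneg fun b _ => by split_ifs <;> positivity

theorem acceptProb_le_one {n : ℕ} (A : QueryAlgorithm n) (σ : Equiv.Perm (BitString n))
    (y : BitString n) : A.acceptProb σ y ≤ 1 := by
  have h := EuclideanSpace.norm_sq_eq (A.stateAfter σ y A.queries)
  rw [norm_stateAfter, one_pow] at h
  rw [h]
  exact Finset.sum_le_sum fun b _ => by split_ifs <;> first | exact le_rfl | positivity

/-- Factor the difference of squares as `‖p‖² - ‖q‖² ≤ ‖p - q‖ (‖p‖ + ‖q‖)` and apply Cauchy–Schwarz
against the two unit vectors. -/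
theorem acceptProb_le_add_norm {n : ℕ} (A : QueryAlgorithm n) (ρ σ : Equiv.Perm (BitString n))
    (y : BitString n) :
    A.acceptProb ρ y ≤ A.acceptProb σ y +
      2 * ‖A.stateAfter ρ y A.queries - A.stateAfter σ y A.queries‖ := by
  set p := A.stateAfter ρ y A.queries with hp
  set q := A.stateAfter σ y A.queries with hq
  have hp1 : ‖p‖ = 1 := A.norm_stateAfter ρ y _
  have hq1 : ‖q‖ = 1 := A.norm_stateAfter σ y _
  have cs : ∀ r : StateSpace n A.ancillas, ‖r‖ = 1 → ∑ b, ‖(p - q) b‖ * ‖r b‖ ≤ ‖p - q‖ := by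
    intro r hr
    have := Real.sum_mul_le_sqrt_mul_sqrt Finset.univ (fun b => ‖(p - q) b‖) fun b => ‖r b‖
    rwa [← EuclideanSpace.norm_eq, ← EuclideanSpace.norm_eq, hr, mul_one] at this
  have h : A.acceptProb ρ y - A.acceptProb σ y ≤
      ∑ b, (‖(p - q) b‖ * ‖p b‖ + ‖(p - q) b‖ * ‖q b‖) := by
    unfold acceptProb
    rw [← Finset.sum_sub_distrib]
    refine Finset.sum_le_sum fun b _ => ?_
    rw [← hp, ← hq]
    split_ifs
    · have h1 := norm_sub_norm_le (p b) (q b)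
      rw [PiLp.sub_apply]
      nlinarith [norm_nonneg (p b), norm_nonneg (q b)]
    · rw [sub_zero]
      positivity
  rw [Finset.sum_add_distrib] at h
  linarith [cs p hp1, cs q hq1]

/-- Exchanging two values of the permutation is noticed only by querying them. -/
theorem acceptProb_swap_le {n : ℕ} (A : QueryAlgorithm n) (σ : Equiv.Perm (BitString n))
    (y u v : BitString n) {ε : ℝ} (hε : 0 < ε) :
    A.acceptProb (σ * Equiv.swap u v) y ≤ A.acceptProb σ y +
      ∑ t ∈ Finset.range A.queries, (2 * ε + 2 / ε * swapMass (A.stateAfter σ y t) σ u v) := by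
  refine (A.acceptProb_le_add_norm _ σ y).trans ?_
  refine add_le_add_right ?_ _
  refine (mul_le_mul_of_nonneg_left (A.norm_stateAfter_sub_le _ σ y _) zero_le_two).trans ?_
  rw [Finset.mul_sum]
  refine Finset.sum_le_sum fun t _ => ?_
  -- From `x² ≤ 4w` and `(2ε - x)² ≥ 0`. Unlike `4√w`, the bound is linear in `w`, so it can be
  -- averaged directly.
  have h := norm_oracle_sub_sq_le (A.stateAfter σ y t) σ u v
  set x := ‖oracle (σ * Equiv.swap u v) (A.stateAfter σ y t) - oracle σ (A.stateAfter σ y t)‖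
  set w := swapMass (A.stateAfter σ y t) σ u v
  rw [div_mul_eq_mul_div, ← sub_nonneg]
  have e : 2 * ε + 2 * w / ε - 2 * x = (4 * ε ^ 2 + 4 * w - 4 * ε * x) / (2 * ε) := by
    field_simp
    ring
  rw [e]
  refine div_nonneg ?_ (by positivity)
  nlinarith [sq_nonneg (2 * ε - x)]

end QueryAlgorithm

/-! ### Cutting and reversing paths -/

/-- The word that addresses the node reached by a sequence of branchings. -/
def word {k : ℕ} (s : Fin k → Bool) : List Bool := (List.ofFn s).reverse

@[simp]
theorem length_word {k : ℕ} (s : Fin k → Bool) : (word s).length = k := by simp [word]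

theorem word_injective (k : ℕ) : Function.Injective (word : (Fin k → Bool) → List Bool) :=
  List.reverse_injective.comp List.ofFn_injective

theorem word_append {k m : ℕ} (f : Fin k → Bool) (g : Fin m → Bool) :
    word (Fin.append f g) = word g ++ word f := by
  simp [word, List.ofFn_fin_append]

/-- The first branching acts before any value of `σ` and only selects the root; no flip follows the
last `σ`. Hence `k + 1` steps correspond to a word of length `k`. -/
theorem endpoint_cons {n k : ℕ} (σ : Equiv.Perm (BitString n)) (b : Bool) (s : Fin k → Bool) :
    endpoint σ (k + 1) (Fin.cons b s) = σ (node σ (flipIf b (zeroString n)) (word s)) := by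
  induction k with
  | zero => exact step_eq_flipIf σ b _
  | succ k ih =>
    have h1 : (fun i : Fin (k + 1) => (Fin.cons b s : Fin (k + 2) → Bool) i.castSucc) =
        Fin.cons b fun i => s i.castSucc := by
      funext i
      refine Fin.cases rfl (fun i => ?_) i
      rw [← Fin.succ_castSucc, Fin.cons_succ, Fin.cons_succ]
    have h2 : word s = s (Fin.last k) :: word fun i => s i.castSucc := by
      simp only [word]
      rw [List.ofFn_succ', List.concat_eq_append, List.reverse_append]
      rfl
    rw [endpoint, h1, ih, step_eq_flipIf, h2]
    rfl

/-- Since `X_1` is an involution, a path run backwards is a path in the tree of `σ⁻¹` with the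
branchings reversed. -/
theorem apply_node_eq_iff {n : ℕ} (σ : Equiv.Perm (BitString n)) (v y : BitString n)
    (L : List Bool) : σ (node σ v L) = y ↔ v = σ.symm (node σ.symm y L.reverse) := by
  induction L generalizing y with
  | nil => exact (Equiv.eq_symm_apply σ).symm
  | cons b L ih =>
    rw [List.reverse_cons, node_append, ← ih, node, ← Equiv.eq_symm_apply]
    constructor
    · intro h
      rw [node, node, ← h, flipIf_flipIf]
    · intro h
      rw [h, node, node, flipIf_flipIf]

theorem sum_apply_node {n : ℕ} (σ : Equiv.Perm (BitString n)) (L : List Bool)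
    (F : BitString n → BitString n → ℝ) :
    ∑ v, F v (σ (node σ v L)) = ∑ y, F (σ.symm (node σ.symm y L.reverse)) y := by
  refine Finset.sum_nbij' (fun v => σ (node σ v L)) (fun y => σ.symm (node σ.symm y L.reverse))
    (by simp) (by simp) (fun v _ => ((apply_node_eq_iff σ v _ L).1 rfl).symm)
    (fun y _ => (apply_node_eq_iff σ _ y L).2 rfl) fun v _ => ?_
  rw [← (apply_node_eq_iff σ v _ L).1 rfl]

/-- The points visited on the way to a node, and the node itself. -/
def pathNodes {n : ℕ} (σ : Equiv.Perm (BitString n)) (a : BitString n) (L : List Bool) :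
    Finset (BitString n) :=
  L.tails.toFinset.image (node σ a)

theorem card_pathNodes_le {n : ℕ} (σ : Equiv.Perm (BitString n)) (a : BitString n)
    (L : List Bool) : (pathNodes σ a L).card ≤ L.length + 1 := by
  refine Finset.card_image_le.trans ((List.toFinset_card_le _).trans ?_)
  simp

theorem node_ne_of_notMem_pathNodes {n : ℕ} {σ : Equiv.Perm (BitString n)} {a v : BitString n}
    {L K : List Bool} (hv : v ∉ pathNodes σ a L) (hK : K <:+ L) : node σ a K ≠ v := by
  rintro rfl
  exact hv (Finset.mem_image_of_mem _ (by simpa using hK))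

section Exchange

variable {n : ℕ} {σ : Equiv.Perm (BitString n)} {a v : BitString n} {F G : List Bool}

theorem node_swap_start (hσ : TreeInjective σ a (G ++ F).length)
    (hv : v ∉ pathNodes σ a (G ++ F)) :
    node (σ * Equiv.swap (node σ a F) v) a F = node σ a F := by
  refine node_congr F fun K hK hlt => swap_apply_node σ (fun h => ?_)
    (node_ne_of_notMem_pathNodes hv (hK.trans (List.suffix_append G F)))
  have hF : F.length ≤ (G ++ F).length := by simp
  have : K = F := hσ (show K.length ≤ _ by omega) hF h
  rw [this] at hlt
  omega

/-- The exchange gives `v` the value that the cut point had. From there the two walks agree, since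
later nodes avoid both exchanged points. -/
theorem apply_node_swap (hσ : TreeInjective σ a (G ++ F).length)
    (hv : v ∉ pathNodes σ a (G ++ F)) :
    (σ * Equiv.swap (node σ a F) v) (node (σ * Equiv.swap (node σ a F) v) v G) =
      σ (node σ a (G ++ F)) := by
  induction G with
  | nil => simp [node]
  | cons b G ih =>
    have hsuf : G ++ F <:+ b :: G ++ F := List.suffix_cons b (G ++ F)
    have hv' : v ∉ pathNodes σ a (G ++ F) := fun h => by
      obtain ⟨K, hK, hKv⟩ := Finset.mem_image.1 h
      exact node_ne_of_notMem_pathNodes hv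
        (List.IsSuffix.trans ((List.mem_tails K _).1 (List.mem_toFinset.1 hK)) hsuf) hKv
    have hlen : (G ++ F).length ≤ (b :: G ++ F).length := by simp
    rw [node, ih (hσ.mono hlen) hv']
    refine swap_apply_node σ (fun h => ?_) (node_ne_of_notMem_pathNodes hv List.suffix_rfl)
    have hF : F.length ≤ (b :: G ++ F).length := by
      simp only [List.cons_append, List.length_cons, List.length_append]
      omega
    have := congrArg List.length (hσ (show (b :: G ++ F).length ≤ _ from le_rfl) hF h)
    simp only [List.cons_append, List.length_cons, List.length_append] at this
    omega

end Exchange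

/-- Cutting the path to a random leaf in its middle: the leaf can be replaced by a node reached
from a uniformly random string. -/
theorem sum_leaf_le {n : ℕ} (a : BitString n) (F G : List Bool)
    (Φ : Equiv.Perm (BitString n) → BitString n → ℝ) (h0 : ∀ σ y, 0 ≤ Φ σ y)
    (h1 : ∀ σ y, Φ σ y ≤ 1) {β : ℝ}
    (hβ : ∑ σ : Equiv.Perm (BitString n),
      (open Classical in if TreeInjective σ a (G ++ F).length then (0 : ℝ) else 1) ≤ β) :
    ∑ σ : Equiv.Perm (BitString n), (2 : ℝ) ^ n * Φ σ (σ (node σ a (G ++ F))) ≤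
      (2 : ℝ) ^ n * β +
        Fintype.card (Equiv.Perm (BitString n)) * ((G ++ F).length + 1 : ℝ) +
        ∑ σ : Equiv.Perm (BitString n), ∑ y,
          Φ (σ * Equiv.swap (node σ a F) (σ.symm (node σ.symm y G.reverse))) y := by
  classical
  set L := G ++ F with hL
  set P : Finset (Equiv.Perm (BitString n) × BitString n) :=
    Finset.univ.filter fun p => TreeInjective p.1 a L.length ∧ p.2 ∉ pathNodes p.1 a L with hP
  set H : Equiv.Perm (BitString n) × BitString n → ℝ := fun p =>
    Φ (p.1 * Equiv.swap (node p.1 a F) p.2) (p.1 (node p.1 p.2 G)) with hH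
  set e : Equiv.Perm (BitString n) × BitString n → Equiv.Perm (BitString n) × BitString n :=
    fun p => (p.1 * Equiv.swap (node p.1 a F) p.2, p.2) with he
  have hstart : ∀ p ∈ P, node (e p).1 a F = node p.1 a F := fun p hp =>
    node_swap_start (Finset.mem_filter.1 hp).2.1 (Finset.mem_filter.1 hp).2.2
  -- The exchange does not move the cut point, so repeating it restores the permutation.
  have hback : ∀ p ∈ P, (e p).1 * Equiv.swap (node (e p).1 a F) p.2 = p.1 := fun p hp => by
    rw [hstart p hp]
    simp [he, mul_assoc]
  have hinj : Set.InjOn e P := by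
    intro p hp q hq hpq
    have h2 : p.2 = q.2 := (congrArg Prod.snd hpq :)
    refine Prod.ext ?_ h2
    rw [← hback p hp, ← hback q hq, hpq, h2]
  have hgood : ∑ p ∈ P, Φ p.1 (p.1 (node p.1 a L)) ≤ ∑ p, H p := by
    have : ∑ p ∈ P, Φ p.1 (p.1 (node p.1 a L)) = ∑ p ∈ P, H (e p) := by
      refine Finset.sum_congr rfl fun p hp => ?_
      have h3 := apply_node_swap (Finset.mem_filter.1 hp).2.1 (Finset.mem_filter.1 hp).2.2
      have h4 := hback p hp
      simp only [hH]
      rw [show (e p).2 = p.2 from rfl, h4]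
      exact congrArg _ h3.symm
    rw [this, ← Finset.sum_image hinj]
    exact Finset.sum_le_sum_of_subset_of_nonneg (Finset.subset_univ _) fun p _ _ => h0 _ _
  -- Outside `P` there is a coincidence or `v` lies on the path, and `Φ ≤ 1` is paid for by the
  -- indicators.
  have hpt : ∀ p : Equiv.Perm (BitString n) × BitString n, Φ p.1 (p.1 (node p.1 a L)) ≤
      (if TreeInjective p.1 a L.length then (0 : ℝ) else 1) +
        (if p.2 ∈ pathNodes p.1 a L then 1 else 0) +
        if p ∈ P then Φ p.1 (p.1 (node p.1 a L)) else 0 := by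
    intro p
    have := h1 p.1 (p.1 (node p.1 a L))
    have := h0 p.1 (p.1 (node p.1 a L))
    by_cases hA : TreeInjective p.1 a L.length <;> by_cases hB : p.2 ∈ pathNodes p.1 a L <;>
      simp only [hP, Finset.mem_filter, Finset.mem_univ, hA, hB, not_true,
        not_false_eq_true, and_true, and_false, if_true, if_false] <;> linarith
  have hconst : ∀ c : ℝ, ∑ _v : BitString n, c = (2 : ℝ) ^ n * c := fun c => by simp
  have hlhs : ∑ σ : Equiv.Perm (BitString n), (2 : ℝ) ^ n * Φ σ (σ (node σ a L)) =
      ∑ p : Equiv.Perm (BitString n) × BitString n, Φ p.1 (p.1 (node p.1 a L)) := by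
    rw [Fintype.sum_prod_type]
    exact Finset.sum_congr rfl fun σ _ => (hconst _).symm
  have hbad1 : ∑ p : Equiv.Perm (BitString n) × BitString n,
      (if TreeInjective p.1 a L.length then (0 : ℝ) else 1) ≤ (2 : ℝ) ^ n * β := by
    rw [Fintype.sum_prod_type]
    refine (Finset.sum_le_sum fun σ _ =>
      (hconst (if TreeInjective σ a L.length then 0 else 1)).le).trans ?_
    rw [← Finset.mul_sum]
    refine mul_le_mul_of_nonneg_left (le_trans (le_of_eq ?_) hβ) (by positivity)
    exact Finset.sum_congr rfl fun σ _ => by congr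
  have hbad2 : ∑ p : Equiv.Perm (BitString n) × BitString n,
      (if p.2 ∈ pathNodes p.1 a L then (1 : ℝ) else 0) ≤
        Fintype.card (Equiv.Perm (BitString n)) * (L.length + 1 : ℝ) := by
    rw [Fintype.sum_prod_type, ← nsmul_eq_mul]
    refine Finset.sum_le_card_nsmul _ _ _ fun σ _ => ?_
    simp only [Finset.sum_ite_mem, Finset.univ_inter, Finset.sum_const, nsmul_eq_mul, mul_one]
    exact_mod_cast card_pathNodes_le σ a L
  have hideal : ∑ p, H p = ∑ σ : Equiv.Perm (BitString n), ∑ y,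
      Φ (σ * Equiv.swap (node σ a F) (σ.symm (node σ.symm y G.reverse))) y := by
    rw [Fintype.sum_prod_type]
    exact Finset.sum_congr rfl fun σ _ =>
      sum_apply_node σ G fun v y => Φ (σ * Equiv.swap (node σ a F) v) y
  rw [hlhs, ← hideal]
  refine (Finset.sum_le_sum fun p _ => hpt p).trans ?_
  rw [Finset.sum_add_distrib, Finset.sum_add_distrib, Finset.sum_ite_mem, Finset.univ_inter]
  linarith

theorem sum_comm_pairs {ι κ α β : Type*} [Fintype ι] [Fintype κ] [Fintype α] [Fintype β]
    (F : ι → κ → α → β → ℝ) :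
    ∑ i, ∑ k, ∑ x, ∑ y, F i k x y = ∑ x, ∑ y, ∑ i, ∑ k, F i k x y := by
  have h := Finset.sum_comm (s := (Finset.univ : Finset (ι × κ)))
    (t := (Finset.univ : Finset (α × β))) (f := fun p q => F p.1 p.2 q.1 q.2)
  simpa only [Fintype.sum_prod_type] using h

open Classical in
theorem sum_not_treeInjective_le {n : ℕ} (hn : 0 < n) (a : BitString n) {j l : ℕ} (hjl : j ≤ l)
    (hl : 2 ^ (l + 1) ≤ 2 ^ n) :
    ∑ σ : Equiv.Perm (BitString n), (if TreeInjective σ a j then (0 : ℝ) else 1) ≤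
      2 * 4 ^ (l + 1) / 2 ^ n * Fintype.card (Equiv.Perm (BitString n)) := by
  have h := card_not_treeInjective hn a j
    (le_trans (Nat.pow_le_pow_right (by norm_num) (by omega)) hl)
  have e : ∑ σ : Equiv.Perm (BitString n), (if TreeInjective σ a j then (0 : ℝ) else 1) =
      ((Finset.univ.filter fun σ : Equiv.Perm (BitString n) => ¬ TreeInjective σ a j).card : ℝ) := by
    rw [Finset.card_filter]
    push_cast
    exact Finset.sum_congr rfl fun σ _ => by split_ifs <;> simp_all
  have h4 : (4 : ℝ) ^ (j + 1) ≤ 4 ^ (l + 1) := pow_le_pow_right₀ (by norm_num) (by omega)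
  rw [e, div_mul_eq_mul_div, le_div_iff₀ (by positivity)]
  calc _ ≤ (2 : ℝ) * 4 ^ (j + 1) * Fintype.card (Equiv.Perm (BitString n)) := by exact_mod_cast h
    _ ≤ _ := by gcongr

/-! ### Averaging over the hidden points -/

namespace QueryAlgorithm

/-- The hybrid argument, averaged over the words that address the two exchanged points. -/
theorem sum_acceptProb_swap_le {n r m : ℕ} (A : QueryAlgorithm n) (hm : 2 * r ≤ m)
    (σ : Equiv.Perm (BitString n)) (a y : BitString n) (hσ : TreeInjective σ a (2 * r))
    (hτ : TreeInjective σ.symm y m) :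
    ∑ f : Fin (2 * r) → Bool, ∑ g : Fin m → Bool,
      A.acceptProb (σ * Equiv.swap (node σ a (word f))
        (σ.symm (node σ.symm y (word g).reverse))) y ≤
      2 ^ (2 * r) * 2 ^ m * (A.acceptProb σ y + 8 * A.queries / 2 ^ r) := by
  set u : (Fin (2 * r) → Bool) → BitString n := fun f => node σ a (word f) with hu
  set v : (Fin m → Bool) → BitString n := fun g =>
    σ.symm (node σ.symm y (word g).reverse) with hv
  have hui : Function.Injective u := fun f f' h =>
    word_injective _ (hσ (length_word f).le (length_word f').le h)
  have hvi : Function.Injective v := fun g g' h =>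
    word_injective _ (List.reverse_injective
      (hτ (show (word g).reverse.length ≤ m by simp) (show (word g').reverse.length ≤ m by simp)
        (σ.symm.injective h)))
  -- The state depends on neither `f` nor `g`, and each of the four families has distinct points, so
  -- total mass at most 1. The hypothesis `2 * r ≤ m` makes the `u` terms dominate.
  have hmass : ∀ t, ∑ f, ∑ g, swapMass (A.stateAfter σ y t) σ (u f) (v g) ≤ 4 * 2 ^ m := by
    intro t
    set ψ := A.stateAfter σ y t with hψ
    have hn1 : ‖ψ‖ ^ 2 = 1 := by rw [hψ, A.norm_stateAfter, one_pow]
    have b1 := sum_queryMass_comp_le ψ false u hui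
    have b2 := sum_queryMass_comp_le ψ true (fun f => σ (u f)) (σ.injective.comp hui)
    have b3 := sum_queryMass_comp_le ψ false v hvi
    have b4 := sum_queryMass_comp_le ψ true (fun g => σ (v g)) (σ.injective.comp hvi)
    rw [hn1] at b1 b2 b3 b4
    have e : ∑ f, ∑ g, swapMass ψ σ (u f) (v g) =
        2 ^ m * (∑ f, queryMass ψ false (u f) + ∑ f, queryMass ψ true (σ (u f))) +
        2 ^ (2 * r) * (∑ g, queryMass ψ false (v g) + ∑ g, queryMass ψ true (σ (v g))) := by
      simp only [swapMass, Finset.sum_add_distrib, Finset.sum_const, Finset.card_univ,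
        Fintype.card_pi, Fintype.card_bool, Finset.prod_const, Fintype.card_fin, nsmul_eq_mul,
        ← Finset.mul_sum, Nat.cast_pow, Nat.cast_ofNat]
      ring
    have hp : (2 : ℝ) ^ (2 * r) ≤ 2 ^ m := pow_le_pow_right₀ (by norm_num) hm
    have hp0 : (0 : ℝ) < 2 ^ (2 * r) := by positivity
    rw [e]
    have c1 : 2 ^ m * (∑ f, queryMass ψ false (u f) + ∑ f, queryMass ψ true (σ (u f))) ≤
        (2 : ℝ) ^ m * 2 := mul_le_mul_of_nonneg_left (by linarith) (by positivity)
    have c2 : 2 ^ (2 * r) * (∑ g, queryMass ψ false (v g) + ∑ g, queryMass ψ true (σ (v g))) ≤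
        (2 : ℝ) ^ (2 * r) * 2 := mul_le_mul_of_nonneg_left (by linarith) (by positivity)
    linarith
  -- The square root of the bound `4 / 4 ^ r` on the average mass; both error terms become `4 / 2 ^
  -- r` per query.
  have hε : (0 : ℝ) < 2 / 2 ^ r := by positivity
  refine (Finset.sum_le_sum fun f _ => Finset.sum_le_sum fun g _ =>
    A.acceptProb_swap_le σ y (u f) (v g) hε).trans ?_
  have hswap : ∑ f : Fin (2 * r) → Bool, ∑ g : Fin m → Bool,
      ∑ t ∈ Finset.range A.queries, (2 * (2 / 2 ^ r) + 2 / (2 / 2 ^ r) *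
        swapMass (A.stateAfter σ y t) σ (u f) (v g)) ≤
      A.queries * (2 ^ (2 * r) * 2 ^ m * (8 / 2 ^ r)) := by
    have : ∑ f : Fin (2 * r) → Bool, ∑ g : Fin m → Bool,
      ∑ t ∈ Finset.range A.queries, (2 * (2 / 2 ^ r) + 2 / (2 / 2 ^ r) *
        swapMass (A.stateAfter σ y t) σ (u f) (v g)) =
      ∑ t ∈ Finset.range A.queries, ∑ f : Fin (2 * r) → Bool, ∑ g : Fin m → Bool,
        (2 * (2 / (2 : ℝ) ^ r) + 2 / (2 / 2 ^ r) *
        swapMass (A.stateAfter σ y t) σ (u f) (v g)) := by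
      rw [Finset.sum_comm' (t' := Finset.univ) (s' := fun _ => Finset.range A.queries)
        (by simp)]
      refine Finset.sum_congr rfl fun f _ => ?_
      rw [Finset.sum_comm]
    rw [this, ← nsmul_eq_mul]
    refine (Finset.sum_le_card_nsmul _ _ _ fun t _ => ?_).trans (by rw [Finset.card_range])
    have h5 : ∑ f, ∑ g, (2 * (2 / (2 : ℝ) ^ r) + 2 / (2 / 2 ^ r) *
        swapMass (A.stateAfter σ y t) σ (u f) (v g)) =
        2 ^ (2 * r) * 2 ^ m * (2 * (2 / (2 : ℝ) ^ r)) +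
        2 ^ r * ∑ f, ∑ g, swapMass (A.stateAfter σ y t) σ (u f) (v g) := by
      simp only [Finset.sum_add_distrib, Finset.sum_const, Finset.card_univ,
        Fintype.card_pi, Fintype.card_bool, Finset.prod_const, Fintype.card_fin, nsmul_eq_mul,
        ← Finset.mul_sum, Nat.cast_pow, Nat.cast_ofNat]
      field_simp
    rw [h5]
    have h6 := mul_le_mul_of_nonneg_left (hmass t) (show (0 : ℝ) ≤ 2 ^ r by positivity)
    refine (add_le_add_right h6 _).trans (le_of_eq ?_)
    rw [mul_comm 2 r, pow_mul]
    field_simp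
    ring
  simp only [Finset.sum_add_distrib] at hswap ⊢
  refine (add_le_add_right hswap _).trans (le_of_eq ?_)
  simp only [Finset.sum_const, Finset.card_univ,
        Fintype.card_pi, Fintype.card_bool, Finset.prod_const, Fintype.card_fin, nsmul_eq_mul,
        Nat.cast_pow, Nat.cast_ofNat]
  ring

/-- The algorithm accepts a random leaf below a given first step with hardly larger probability
than a uniformly random string. -/
theorem sum_acceptProb_leaf_le {n r m : ℕ} (hn : 0 < n) (A : QueryAlgorithm n) (hm : 2 * r ≤ m)
    (hl : 2 ^ (2 * r + m + 1) ≤ 2 ^ n) (a : BitString n) :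
    ∑ f : Fin (2 * r) → Bool, ∑ g : Fin m → Bool, ∑ σ : Equiv.Perm (BitString n),
      (2 : ℝ) ^ n * A.acceptProb σ (σ (node σ a (word g ++ word f))) ≤
    2 ^ (2 * r) * 2 ^ m * (∑ σ : Equiv.Perm (BitString n), ∑ y, A.acceptProb σ y +
      Fintype.card (Equiv.Perm (BitString n)) *
        (6 * 4 ^ (2 * r + m + 1) + (2 * r + m + 1) + 2 ^ n * (8 * A.queries / 2 ^ r))) := by
  classical
  set C : ℝ := (Fintype.card (Equiv.Perm (BitString n)) : ℝ) with hC
  set β : ℝ := 2 * 4 ^ (2 * r + m + 1) / 2 ^ n * C with hβ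
  have hbound : ∀ (a : BitString n) (j : ℕ), j ≤ 2 * r + m →
      ∑ σ : Equiv.Perm (BitString n), (if TreeInjective σ a j then (0 : ℝ) else 1) ≤ β :=
    fun a j hj => sum_not_treeInjective_le hn a hj hl
  have h1 : ∀ (f : Fin (2 * r) → Bool) (g : Fin m → Bool),
      ∑ σ : Equiv.Perm (BitString n),
        (2 : ℝ) ^ n * A.acceptProb σ (σ (node σ a (word g ++ word f))) ≤
      (2 ^ n * β + C * (2 * r + m + 1)) + ∑ σ : Equiv.Perm (BitString n), ∑ y,
        A.acceptProb (σ * Equiv.swap (node σ a (word f))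
          (σ.symm (node σ.symm y (word g).reverse))) y := by
    intro f g
    have hlen : (word g ++ word f).length = 2 * r + m := by simp [add_comm]
    refine (sum_leaf_le a (word f) (word g) A.acceptProb A.acceptProb_nonneg
      A.acceptProb_le_one (β := β) ?_).trans (le_of_eq ?_)
    · rw [hlen]
      exact hbound a _ le_rfl
    · rw [hlen]
      push_cast
      rfl
  have h2 : ∀ (σ : Equiv.Perm (BitString n)) (y : BitString n),
      ∑ f : Fin (2 * r) → Bool, ∑ g : Fin m → Bool,
        A.acceptProb (σ * Equiv.swap (node σ a (word f))
          (σ.symm (node σ.symm y (word g).reverse))) y ≤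
      2 ^ (2 * r) * 2 ^ m * (A.acceptProb σ y + 8 * A.queries / 2 ^ r +
        (if TreeInjective σ a (2 * r) then (0 : ℝ) else 1) +
        (if TreeInjective σ.symm y m then (0 : ℝ) else 1)) := by
    intro σ y
    by_cases h : TreeInjective σ a (2 * r) ∧ TreeInjective σ.symm y m
    · simpa [h.1, h.2] using A.sum_acceptProb_swap_le hm σ a y h.1 h.2
    · have h3 : (1 : ℝ) ≤ A.acceptProb σ y + 8 * A.queries / 2 ^ r +
        (if TreeInjective σ a (2 * r) then (0 : ℝ) else 1) +
        (if TreeInjective σ.symm y m then (0 : ℝ) else 1) := by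
        have := A.acceptProb_nonneg σ y
        have : (0 : ℝ) ≤ 8 * A.queries / 2 ^ r := by positivity
        split_ifs with h4 h5
        · exact absurd ⟨h4, h5⟩ h
        all_goals linarith
      calc _ ≤ ∑ f : Fin (2 * r) → Bool, ∑ g : Fin m → Bool, (1 : ℝ) :=
            Finset.sum_le_sum fun f _ => Finset.sum_le_sum fun g _ => A.acceptProb_le_one _ _
        _ = 2 ^ (2 * r) * 2 ^ m * 1 := by simp
        _ ≤ _ := mul_le_mul_of_nonneg_left h3 (by positivity)
  have h3 : ∑ f : Fin (2 * r) → Bool, ∑ g : Fin m → Bool, ∑ σ : Equiv.Perm (BitString n), ∑ y,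
        A.acceptProb (σ * Equiv.swap (node σ a (word f))
          (σ.symm (node σ.symm y (word g).reverse))) y ≤
      2 ^ (2 * r) * 2 ^ m * (∑ σ : Equiv.Perm (BitString n), ∑ y, A.acceptProb σ y +
        C * 2 ^ n * (8 * A.queries / 2 ^ r) + 2 ^ n * β + 2 ^ n * β) := by
    have e : ∑ f : Fin (2 * r) → Bool, ∑ g : Fin m → Bool, ∑ σ : Equiv.Perm (BitString n), ∑ y,
        A.acceptProb (σ * Equiv.swap (node σ a (word f))
          (σ.symm (node σ.symm y (word g).reverse))) y =
        ∑ σ : Equiv.Perm (BitString n), ∑ y, ∑ f : Fin (2 * r) → Bool, ∑ g : Fin m → Bool,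
        A.acceptProb (σ * Equiv.swap (node σ a (word f))
          (σ.symm (node σ.symm y (word g).reverse))) y :=
      sum_comm_pairs _
    rw [e]
    refine (Finset.sum_le_sum fun σ _ => Finset.sum_le_sum fun y _ => h2 σ y).trans ?_
    simp only [← Finset.mul_sum, Finset.sum_add_distrib]
    refine mul_le_mul_of_nonneg_left ?_ (by positivity)
    have i1 : ∑ σ : Equiv.Perm (BitString n), ∑ _y : BitString n,
        (8 * A.queries / 2 ^ r : ℝ) = C * 2 ^ n * (8 * A.queries / 2 ^ r) := by
      simp only [Finset.sum_const, Finset.card_univ, nsmul_eq_mul, card_bitString]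
      push_cast
      rw [hC]
      ring
    have i2 : ∑ σ : Equiv.Perm (BitString n), ∑ _y : BitString n,
        (if TreeInjective σ a (2 * r) then (0 : ℝ) else 1) ≤ 2 ^ n * β := by
      rw [Finset.sum_comm]
      refine (Finset.sum_le_card_nsmul _ _ β fun y _ => hbound a _ (by omega)).trans
        (le_of_eq ?_)
      simp
    have i3 : ∑ σ : Equiv.Perm (BitString n), ∑ y : BitString n,
        (if TreeInjective σ.symm y m then (0 : ℝ) else 1) ≤ 2 ^ n * β := by
      rw [Finset.sum_comm]
      refine (Finset.sum_le_card_nsmul _ _ β fun y _ => ?_).trans (le_of_eq ?_)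
      · refine le_trans (le_of_eq ?_) (hbound y m (by omega))
        exact Equiv.sum_comp (Equiv.inv (Equiv.Perm (BitString n)))
          fun τ => if TreeInjective τ y m then (0 : ℝ) else 1
      · simp
    linarith
  refine (Finset.sum_le_sum fun f _ => Finset.sum_le_sum fun g _ => h1 f g).trans ?_
  simp only [Finset.sum_add_distrib]
  refine (add_le_add_right h3 _).trans (le_of_eq ?_)
  -- Occurs three times, whence the 6: for the whole path, for the tree at `a`, and for the backward
  -- tree at `y`.
  have hNβ : (2 : ℝ) ^ n * β = 2 * 4 ^ (2 * r + m + 1) * C := by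
    rw [hβ]
    field_simp
  rw [hNβ]
  simp only [Finset.sum_const, Finset.card_univ,
        Fintype.card_pi, Fintype.card_bool, Finset.prod_const, Fintype.card_fin, nsmul_eq_mul,
        Nat.cast_pow, Nat.cast_ofNat]
  ring

end QueryAlgorithm

/-! ### Success probability and choice of constants -/

theorem sum_leafDist_mul {n : ℕ} (σ : Equiv.Perm (BitString n)) (ℓ : ℕ) (F : BitString n → ℝ) :
    ∑ y, (leafDist σ ℓ y).toReal * F y = (2 ^ ℓ : ℝ)⁻¹ * ∑ s, F (endpoint σ ℓ s) := by
  have h : ∀ y, (leafDist σ ℓ y).toReal =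
      ∑ s : Fin ℓ → Bool, if y = endpoint σ ℓ s then (2 ^ ℓ : ℝ)⁻¹ else 0 := by
    intro y
    rw [leafDist, PMF.map_apply, tsum_fintype, ENNReal.toReal_sum]
    · refine Finset.sum_congr rfl fun s _ => ?_
      split_ifs <;> simp
    · intro s _
      split_ifs <;> simp
  simp only [h, Finset.sum_mul, ite_mul, zero_mul]
  rw [Finset.sum_comm, Finset.mul_sum]
  exact Finset.sum_congr rfl fun s _ => by simp

theorem sum_endpoint {n k m : ℕ} (σ : Equiv.Perm (BitString n)) (F : BitString n → ℝ) :
    ∑ s, F (endpoint σ (k + m + 1) s) = ∑ b : Bool, ∑ f : Fin k → Bool, ∑ g : Fin m → Bool,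
      F (σ (node σ (flipIf b (zeroString n)) (word g ++ word f))) := by
  rw [← Equiv.sum_comp (Fin.consEquiv fun _ : Fin (k + m + 1) => Bool), Fintype.sum_prod_type]
  refine Finset.sum_congr rfl fun b _ => ?_
  rw [← Equiv.sum_comp (Fin.appendEquiv k m), Fintype.sum_prod_type]
  refine Finset.sum_congr rfl fun f _ => Finset.sum_congr rfl fun g _ => ?_
  rw [← word_append, ← endpoint_cons]
  rfl

namespace QueryAlgorithm

/-- The advantage is bounded by the collision probability and the query mass on the cut. -/
theorem successProb_le {n r m : ℕ} (hn : 0 < n) (A : QueryAlgorithm n) (hm : 2 * r ≤ m)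
    (hl : 2 ^ (2 * r + m + 1) ≤ 2 ^ n) :
    A.successProb (2 * r + m + 1) ≤ 1 / 2 + 1 / 2 *
      ((6 * 4 ^ (2 * r + m + 1) + (2 * r + m + 1)) / 2 ^ n + 8 * A.queries / 2 ^ r) := by
  set C : ℝ := (Fintype.card (Equiv.Perm (BitString n)) : ℝ) with hC
  have hC0 : 0 < C := by
    rw [hC]
    exact_mod_cast Fintype.card_pos
  set U : ℝ := ∑ σ : Equiv.Perm (BitString n), ∑ y, A.acceptProb σ y with hU
  set δ : ℝ := 6 * 4 ^ (2 * r + m + 1) + (2 * r + m + 1) + 2 ^ n * (8 * A.queries / 2 ^ r) with hδ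
  have hreal : ∑ σ : Equiv.Perm (BitString n),
      ∑ y, (leafDist σ (2 * r + m + 1) y).toReal * A.acceptProb σ y ≤ (U + C * δ) / 2 ^ n := by
    have e : 2 ^ n * ∑ σ : Equiv.Perm (BitString n),
        ∑ y, (leafDist σ (2 * r + m + 1) y).toReal * A.acceptProb σ y =
        (2 ^ (2 * r + m + 1) : ℝ)⁻¹ * ∑ b : Bool, ∑ f : Fin (2 * r) → Bool, ∑ g : Fin m → Bool,
          ∑ σ : Equiv.Perm (BitString n), (2 : ℝ) ^ n * A.acceptProb σ
            (σ (node σ (flipIf b (zeroString n)) (word g ++ word f))) := by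
      simp only [sum_leafDist_mul, sum_endpoint, ← Finset.mul_sum]
      rw [mul_left_comm]
      congr 2
      rw [Finset.sum_comm]
      refine Finset.sum_congr rfl fun b _ => ?_
      rw [Finset.sum_comm]
      refine Finset.sum_congr rfl fun f _ => ?_
      rw [Finset.sum_comm]
    rw [le_div_iff₀ (by positivity), mul_comm, e]
    have h := Finset.sum_le_sum fun (b : Bool) (_ : b ∈ Finset.univ) =>
      A.sum_acceptProb_leaf_le hn hm hl (flipIf b (zeroString n))
    refine (mul_le_mul_of_nonneg_left h (by positivity)).trans (le_of_eq ?_)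
    rw [← hC, ← hU, ← hδ, Finset.sum_const, Finset.card_univ, Fintype.card_bool, nsmul_eq_mul,
      pow_succ, pow_add]
    push_cast
    field_simp
  have hunif : ∑ σ : Equiv.Perm (BitString n),
      ∑ y : BitString n, ((2 : ℝ) ^ n)⁻¹ * (1 - A.acceptProb σ y) = C - U / 2 ^ n := by
    simp only [← Finset.mul_sum, Finset.sum_sub_distrib, Finset.sum_const, Finset.card_univ,
      nsmul_eq_mul, mul_one, card_bitString]
    rw [← hU, ← hC]
    push_cast
    field_simp
  rw [successProb, ← hC, div_le_iff₀ hC0, Finset.sum_add_distrib, ← Finset.mul_sum,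
    ← Finset.mul_sum, hunif]
  have hfin : (U + C * δ) / 2 ^ n = U / 2 ^ n + C *
      ((6 * 4 ^ (2 * r + m + 1) + (2 * r + m + 1)) / 2 ^ n + 8 * A.queries / 2 ^ r) := by
    rw [hδ]
    field_simp
  rw [hfin] at hreal
  linarith

theorem successProb_le_two_thirds {n ℓ : ℕ} (hn : 4 * ℓ ≤ n) (hℓ : 64 ≤ ℓ) (A : QueryAlgorithm n)
    (hA : (A.queries : ℝ) < (2 : ℝ) ^ ((1 / 8 : ℝ) * (ℓ : ℝ))) : A.successProb ℓ ≤ 2 / 3 := by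
  obtain ⟨r, m, hr, hm, rfl, hr4⟩ : ∃ r m, 15 ≤ r ∧ 2 * r ≤ m ∧ ℓ = 2 * r + m + 1 ∧
      ℓ ≤ 4 * r + 4 := by
    -- The largest `r` compatible with `2 * r ≤ m`.
    refine ⟨(ℓ - 1) / 4, ℓ - 1 - 2 * ((ℓ - 1) / 4), ?_, ?_, ?_, ?_⟩ <;> omega
  refine (A.successProb_le (by omega) hm (Nat.pow_le_pow_right (by norm_num) (by omega))).trans ?_
  set l := 2 * r + m + 1 with hl
  have hq : 8 * (A.queries : ℝ) / 2 ^ r ≤ 1 / 8 := by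
    -- `l / 8 ≤ (r + 1) / 2 ≤ r - 6` once `r ≥ 13`. The 6 spare bits absorb the factor 8 and leave
    -- `1 / 8`; the total `1 / 8 + 1 / 6` stays below `1 / 3`.
    have h1 : (2 : ℝ) ^ ((1 / 8 : ℝ) * (l : ℝ)) ≤ 2 ^ (r - 6) := by
      rw [← Real.rpow_natCast 2 (r - 6)]
      refine Real.rpow_le_rpow_of_exponent_le (by norm_num) ?_
      have h2 : (l : ℝ) ≤ 4 * r + 4 := by exact_mod_cast hr4
      have h3 : (15 : ℝ) ≤ r := by exact_mod_cast hr
      rw [Nat.cast_sub (by omega)]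
      push_cast
      linarith
    have h4 : (2 : ℝ) ^ r = 2 ^ (r - 6) * 64 := by
      rw [show (64 : ℝ) = 2 ^ 6 by norm_num, ← pow_add]
      congr 1
      omega
    rw [div_le_iff₀ (by positivity), h4]
    linarith
  have hN : (6 * 4 ^ l + (2 * r + m + 1 : ℝ)) / 2 ^ n ≤ 1 / 6 := by
    have h1 : (2 * r + m + 1 : ℝ) ≤ 4 ^ l := by
      have : l ≤ 4 ^ l := (Nat.lt_pow_self (by norm_num)).le
      have h2 : ((2 * r + m + 1 : ℕ) : ℝ) ≤ 4 ^ l := by exact_mod_cast this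
      push_cast at h2
      exact h2
    have h2 : (64 : ℝ) * 4 ^ l ≤ 2 ^ n := by
      rw [show (64 : ℝ) * 4 ^ l = 2 ^ (6 + 2 * l) by
        rw [pow_add 2 6, pow_mul]
        norm_num]
      exact pow_le_pow_right₀ (by norm_num) (by omega)
    have h3 : (0 : ℝ) < 4 ^ l := by positivity
    rw [div_le_iff₀ (by positivity)]
    linarith
  linarith

end QueryAlgorithm

end ClassicalPR

end

theorem mainTheorem1 :
    ∃ c : ℝ, 0 < c ∧ ∃ ℓ₀ : ℕ, ∀ ℓ : ℕ → ℕ,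
      (fun n : ℕ => (ℓ n : ℝ)) =o[atTop] (fun n : ℕ => (n : ℝ)) →
        ∀ᶠ n : ℕ in atTop, ℓ₀ ≤ ℓ n →
          ∀ A : ClassicalPR.QueryAlgorithm n,
            (A.queries : ℝ) < (2 : ℝ) ^ (c * (ℓ n : ℝ)) →
              A.successProb (ℓ n) ≤ 2 / 3 := by
  refine ⟨1 / 8, by norm_num, 64, fun ℓ hℓ => ?_⟩
  -- Of `ℓ = o(n)` only `4ℓ ≤ n` for large `n` is needed: it keeps `4 ^ ℓ` far below `2 ^ n`.
  filter_upwards [hℓ.bound (show (0 : ℝ) < 1 / 4 by norm_num)] with n hn h64 A hA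
  refine A.successProb_le_two_thirds ?_ h64 hA
  simp only [Real.norm_natCast] at hn
  have : (4 : ℝ) * ℓ n ≤ n := by linarith
  exact_mod_cast this
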